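/- Let $M$ be a smooth (finite-dimensional, boundaryless) Riemannian manifold with Levi-Civita connection $\nabla$, and let $\Sigma$ be a connected, (possibly only immersed) smooth totally geodesic submanifold of $M$, i.e. one whose second fundamental form vanishes identically. For $q \in \Sigma$ let $N_q\Sigma$ denote the normal space, i.e. the orthogonal complement of $T_q\Sigma$ in $T_qM$. Let $p \in \Sigma$ and let $X$ be a Killing vector field on $M$, i.e. a smooth vector field along which the Lie derivative of the metric vanishes. Then $X(q) \in N_q\Sigma$ holds for all $q \in \Sigma$ if and only if $X(p) \in N_p\Sigma$ and $\nabla_v X \in N_p\Sigma$ for all $v \in T_p\Sigma$. -/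

import Mathlib

open Bundle
open scoped Manifold ContDiff

noncomputable section

namespace RiemannianGeometry

variable {E : Type*} [NormedAddCommGroup E] [NormedSpace ℝ E] [FiniteDimensional ℝ E]
  {H : Type*} [TopologicalSpace H] {I : ModelWithCorners ℝ E H}
  {M : Type*} [TopologicalSpace M] [ChartedSpace H M] [IsManifold I ∞ M]
  [RiemannianBundle (fun x : M ↦ TangentSpace I x)]
  [IsContMDiffRiemannianBundle I ∞ E (fun x : M ↦ TangentSpace I x)]

/-! ### The Levi-Civita connection -/

/-- The right-hand side of the Koszul formula, whose value at `x` is `2 ⟨∇_X Y, Z⟩`. -/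
def koszul (X Y Z : Π x : M, TangentSpace I x) (x : M) : ℝ :=
  d% (fun y : M ↦ inner ℝ (Y y) (Z y)) x (X x)
    + d% (fun y : M ↦ inner ℝ (X y) (Z y)) x (Y x)
    - d% (fun y : M ↦ inner ℝ (X y) (Y y)) x (Z x)
    + inner ℝ (VectorField.mlieBracket I X Y x) (Z x)
    - inner ℝ (VectorField.mlieBracket I X Z x) (Y x)
    - inner ℝ (VectorField.mlieBracket I Y Z x) (X x)

theorem mdiffAt_inner {X Y : Π x : M, TangentSpace I x} {x : M}
    (hX : MDiffAt (T% X) x) (hY : MDiffAt (T% Y) x) :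
    MDiffAt (fun y : M ↦ (inner ℝ (X y) (Y y) : ℝ)) x := by
  have : IsContMDiffRiemannianBundle I 1 E (fun x : M ↦ TangentSpace I x) := inferInstance
  exact MDifferentiableAt.inner_bundle (E := fun x : M ↦ TangentSpace I x) hX hY

theorem koszul_tensorial_right {X Y : Π x : M, TangentSpace I x} {x : M}
    (hX : MDiffAt (T% X) x) (hY : MDiffAt (T% Y) x) :
    TensorialAt I E (fun Z ↦ koszul X Y Z x) x where
  smul {f Z} hf hZ := by
    have : CompleteSpace E := FiniteDimensional.complete ℝ E
    have : IsManifold I 2 M := inferInstance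
    simp only [koszul, VectorField.mlieBracket_smul_right hf hZ, Pi.smul_apply', real_inner_smul_left,
      real_inner_smul_right, inner_add_left, map_smul]
    rw [mvfderiv_fun_mul hf (mdiffAt_inner hY hZ), mvfderiv_fun_mul hf (mdiffAt_inner hX hZ)]
    simp
    rw [real_inner_comm (Y x) (Z x), real_inner_comm (X x) (Z x)]
    ring
  add {Z Z'} hZ hZ' := by
    have : CompleteSpace E := FiniteDimensional.complete ℝ E
    have : IsManifold I 2 M := inferInstance
    simp only [koszul, VectorField.mlieBracket_add_right hZ hZ', Pi.add_apply,
      inner_add_right, inner_add_left, map_add]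
    rw [mvfderiv_fun_add (mdiffAt_inner hY hZ) (mdiffAt_inner hY hZ'),
      mvfderiv_fun_add (mdiffAt_inner hX hZ) (mdiffAt_inner hX hZ')]
    simp
    ring

theorem koszul_tensorial_left {Y Z : Π x : M, TangentSpace I x} {x : M}
    (hY : MDiffAt (T% Y) x) (hZ : MDiffAt (T% Z) x) :
    TensorialAt I E (fun X ↦ koszul X Y Z x) x where
  smul {f X} hf hX := by
    have : CompleteSpace E := FiniteDimensional.complete ℝ E
    have : IsManifold I 2 M := inferInstance
    simp only [koszul, VectorField.mlieBracket_smul_left hf hX, Pi.smul_apply', real_inner_smul_left,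
      real_inner_smul_right, inner_add_left, map_smul]
    rw [mvfderiv_fun_mul hf (mdiffAt_inner hX hZ), mvfderiv_fun_mul hf (mdiffAt_inner hX hY)]
    simp
    ring
  add {X X'} hX hX' := by
    have : CompleteSpace E := FiniteDimensional.complete ℝ E
    have : IsManifold I 2 M := inferInstance
    simp only [koszul, VectorField.mlieBracket_add_left hX hX', Pi.add_apply,
      inner_add_right, inner_add_left, map_add]
    rw [mvfderiv_fun_add (mdiffAt_inner hX hZ) (mdiffAt_inner hX' hZ),
      mvfderiv_fun_add (mdiffAt_inner hX hY) (mdiffAt_inner hX' hY)]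
    simp
    ring

theorem koszul_add_middle {X Y Y' Z : Π x : M, TangentSpace I x} {x : M}
    (hX : MDiffAt (T% X) x) (hY : MDiffAt (T% Y) x) (hY' : MDiffAt (T% Y') x)
    (hZ : MDiffAt (T% Z) x) :
    koszul X (Y + Y') Z x = koszul X Y Z x + koszul X Y' Z x := by
  have : CompleteSpace E := FiniteDimensional.complete ℝ E
  have : IsManifold I 2 M := inferInstance
  simp only [koszul, VectorField.mlieBracket_add_left hY hY',
    VectorField.mlieBracket_add_right hY hY', Pi.add_apply,
    inner_add_right, inner_add_left, map_add]
  rw [mvfderiv_fun_add (mdiffAt_inner hY hZ) (mdiffAt_inner hY' hZ),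
    mvfderiv_fun_add (mdiffAt_inner hX hY) (mdiffAt_inner hX hY')]
  simp
  ring

theorem koszul_smul_middle {X Y Z : Π x : M, TangentSpace I x} {f : M → ℝ} {x : M}
    (hX : MDiffAt (T% X) x) (hY : MDiffAt (T% Y) x) (hZ : MDiffAt (T% Z) x) (hf : MDiffAt f x) :
    koszul X (f • Y) Z x
      = f x * koszul X Y Z x + 2 * (d% f x (X x) * inner ℝ (Y x) (Z x)) := by
  have : CompleteSpace E := FiniteDimensional.complete ℝ E
  have : IsManifold I 2 M := inferInstance
  simp only [koszul, VectorField.mlieBracket_smul_left hf hY,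
    VectorField.mlieBracket_smul_right hf hY, Pi.smul_apply', real_inner_smul_left,
    real_inner_smul_right, inner_add_left, map_smul]
  rw [mvfderiv_fun_mul hf (mdiffAt_inner hY hZ), mvfderiv_fun_mul hf (mdiffAt_inner hX hY)]
  simp
  rw [real_inner_comm (Y x) (X x)]
  ring

/-- The Koszul expression `2 ⟨∇_v Y, w⟩` as a bilinear form in the tangent vectors `v`, `w` at `x`,
for a vector field `Y` that is differentiable at `x`. -/
def koszulForm {Y : Π x : M, TangentSpace I x} {x : M} (hY : MDiffAt (T% Y) x) :
    TangentSpace I x →L[ℝ] TangentSpace I x →L[ℝ] ℝ :=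
  TensorialAt.mkHom₂ (I := I) (F := E) (F' := E) (fun X Z ↦ koszul X Y Z x) x
    (fun _ hZ ↦ koszul_tensorial_left hY hZ) (fun _ hX ↦ koszul_tensorial_right hX hY)

theorem koszulForm_apply {X Y Z : Π x : M, TangentSpace I x} {x : M}
    (hX : MDiffAt (T% X) x) (hY : MDiffAt (T% Y) x) (hZ : MDiffAt (T% Z) x) :
    koszulForm hY (X x) (Z x) = koszul X Y Z x :=
  TensorialAt.mkHom₂_apply _ _ hX hZ

theorem exists_leviCivitaAt {Y : Π x : M, TangentSpace I x} {x : M} (hY : MDiffAt (T% Y) x) :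
    ∃ L : TangentSpace I x →L[ℝ] TangentSpace I x,
      ∀ v w : TangentSpace I x, 2 * (inner ℝ (L v) w : ℝ) = koszulForm hY v w := by
  have : FiniteDimensional ℝ (TangentSpace I x) := inferInstanceAs (FiniteDimensional ℝ E)
  have : CompleteSpace (TangentSpace I x) := FiniteDimensional.complete ℝ _
  let D := InnerProductSpace.toDual ℝ (TangentSpace I x)
  refine ⟨LinearMap.toContinuousLinearMap
    { toFun := fun v ↦ (1 / 2 : ℝ) • D.symm (koszulForm hY v)
      map_add' := fun v v' ↦ by simp
      map_smul' := fun c v ↦ by simp [smul_comm c] }, fun v w ↦ ?_⟩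
  simp [real_inner_smul_left, D]

open scoped Classical in
/-- `∇ Y` at the point `x`: the linear map `v ↦ ∇_v Y` given by the Koszul formula
(and, by convention, `0` if `Y` is not differentiable at `x`). -/
def leviCivitaAt (Y : Π x : M, TangentSpace I x) (x : M) :
    TangentSpace I x →L[ℝ] TangentSpace I x :=
  if hY : MDiffAt (T% Y) x then (exists_leviCivitaAt hY).choose else 0

/-- The Koszul formula. -/
theorem inner_leviCivitaAt {X Y Z : Π x : M, TangentSpace I x} {x : M}
    (hX : MDiffAt (T% X) x) (hY : MDiffAt (T% Y) x) (hZ : MDiffAt (T% Z) x) :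
    2 * (inner ℝ (leviCivitaAt Y x (X x)) (Z x) : ℝ) = koszul X Y Z x := by
  rw [leviCivitaAt, dif_pos hY, (exists_leviCivitaAt hY).choose_spec, koszulForm_apply hX hY hZ]

theorem tangent_ext {x : M} {a b : TangentSpace I x}
    (h : ∀ Z : Π x : M, TangentSpace I x, MDiffAt (T% Z) x →
      (inner ℝ a (Z x) : ℝ) = inner ℝ b (Z x)) : a = b := by
  refine ext_inner_right ℝ fun w ↦ ?_
  have := h (FiberBundle.extend E w) (FiberBundle.mdifferentiableAt_extend ..)
  simpa using this

variable (I M) in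
/-- The Levi-Civita connection of a Riemannian manifold, defined by the Koszul formula:
`leviCivita I M Y x v` is `∇_v Y` for `v ∈ T_x M`. -/
def leviCivita : CovariantDerivative I E (fun x : M ↦ TangentSpace I x) where
  toFun := leviCivitaAt
  isCovariantDerivativeOnUniv :=
    { add := by
        intro Y Y' x hY hY' _
        ext1 v
        obtain ⟨X, hX, rfl⟩ : ∃ X : Π x : M, TangentSpace I x, MDiffAt (T% X) x ∧ X x = v :=
          ⟨FiberBundle.extend E v, FiberBundle.mdifferentiableAt_extend .., by simp⟩
        refine tangent_ext fun Z hZ ↦ ?_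
        have h := inner_leviCivitaAt hX (mdifferentiableAt_add_section hY hY') hZ
        have h1 := inner_leviCivitaAt hX hY hZ
        have h2 := inner_leviCivitaAt hX hY' hZ
        have h3 := koszul_add_middle hX hY hY' hZ
        change 2 * (inner ℝ (leviCivitaAt (Y + Y') x (X x)) (Z x) : ℝ) = koszul X (Y + Y') Z x at h
        rw [add_apply, inner_add_left]
        linarith
      leibniz := by
        intro Y f x hY hf _
        ext1 v
        obtain ⟨X, hX, rfl⟩ : ∃ X : Π x : M, TangentSpace I x, MDiffAt (T% X) x ∧ X x = v :=
          ⟨FiberBundle.extend E v, FiberBundle.mdifferentiableAt_extend .., by simp⟩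
        refine tangent_ext fun Z hZ ↦ ?_
        have h := inner_leviCivitaAt hX (hf.smul_section hY) hZ
        have h1 := inner_leviCivitaAt hX hY hZ
        have h3 := koszul_smul_middle hX hY hZ hf
        change 2 * (inner ℝ (leviCivitaAt (f • Y) x (X x)) (Z x) : ℝ) = koszul X (f • Y) Z x at h
        rw [add_apply, inner_add_left, smul_apply,
          ContinuousLinearMap.smulRight_apply, real_inner_smul_left, real_inner_smul_left]
        linear_combination (h + h3 + f x * -h1) / 2 }

/-- The Levi-Civita connection is torsion-free. -/
theorem leviCivita_torsionFree {X Y : Π x : M, TangentSpace I x} {x : M}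
    (hX : MDiffAt (T% X) x) (hY : MDiffAt (T% Y) x) :
    leviCivita I M Y x (X x) - leviCivita I M X x (Y x) = VectorField.mlieBracket I X Y x := by
  refine tangent_ext fun Z hZ ↦ ?_
  have h1 := inner_leviCivitaAt hX hY hZ
  have h2 := inner_leviCivitaAt hY hX hZ
  have h3 : (fun y : M ↦ (inner ℝ (Y y) (X y) : ℝ)) = fun y ↦ inner ℝ (X y) (Y y) :=
    funext fun y ↦ real_inner_comm _ _
  simp only [koszul] at h1 h2
  rw [h3, VectorField.mlieBracket_swap_apply (V := Y) (W := X), inner_neg_left] at h2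
  rw [inner_sub_left]
  change (inner ℝ (leviCivitaAt Y x (X x)) (Z x) - inner ℝ (leviCivitaAt X x (Y x)) (Z x) : ℝ) = _
  linarith

/-- The Levi-Civita connection is compatible with the metric. -/
theorem leviCivita_metric {X Y Z : Π x : M, TangentSpace I x} {x : M}
    (hX : MDiffAt (T% X) x) (hY : MDiffAt (T% Y) x) (hZ : MDiffAt (T% Z) x) :
    d% (fun y : M ↦ (inner ℝ (Y y) (Z y) : ℝ)) x (X x)
      = inner ℝ (leviCivita I M Y x (X x)) (Z x) + inner ℝ (Y x) (leviCivita I M Z x (X x)) := by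
  have h1 := inner_leviCivitaAt hX hY hZ
  have h2 := inner_leviCivitaAt hX hZ hY
  have h3 : (fun y : M ↦ (inner ℝ (Z y) (Y y) : ℝ)) = fun y ↦ inner ℝ (Y y) (Z y) :=
    funext fun y ↦ real_inner_comm _ _
  simp only [koszul] at h1 h2
  rw [h3, VectorField.mlieBracket_swap_apply (V := Z) (W := Y), inner_neg_left] at h2
  rw [real_inner_comm (leviCivita I M Z x (X x)) (Y x)]
  change _ = (inner ℝ (leviCivitaAt Y x (X x)) (Z x) + inner ℝ (leviCivitaAt Z x (X x)) (Y x) : ℝ)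
  linarith

/-! ### Killing fields -/

/-- A smooth vector field `X` on `M` is a Killing field if the Lie derivative of the metric along
`X` vanishes: `X ⟨Y, Z⟩ = ⟨[X, Y], Z⟩ + ⟨Y, [X, Z]⟩` for all locally defined smooth vector
fields `Y`, `Z`. -/
structure IsKillingField (X : Π x : M, TangentSpace I x) : Prop where
  contMDiff : CMDiff ∞ (T% X)
  lieDeriv_metric : ∀ (Y Z : Π x : M, TangentSpace I x) (U : Set M), IsOpen U →
    CMDiff[U] ∞ (T% Y) → CMDiff[U] ∞ (T% Z) → ∀ x ∈ U,
      d% (fun y : M ↦ (inner ℝ (Y y) (Z y) : ℝ)) x (X x)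
        = inner ℝ (VectorField.mlieBracket I X Y x) (Z x)
          + inner ℝ (Y x) (VectorField.mlieBracket I X Z x)

/-! ### Immersed submanifolds -/

variable {F : Type*} [NormedAddCommGroup F] [NormedSpace ℝ F]
  {G : Type*} [TopologicalSpace G] (J : ModelWithCorners ℝ F G) (I)
  {S : Type*} [TopologicalSpace S] [ChartedSpace G S]

/-- The tangent space at `q` of the submanifold given by `ι : S → M`, as a subspace of the tangent
space of the ambient manifold `M` at `ι q`. -/
def submanifoldTangentSpace (ι : S → M) (q : S) : Submodule ℝ (TangentSpace I (ι q)) :=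
  LinearMap.range (mfderiv J I ι q).toLinearMap

/-- The normal space at `q` of the submanifold given by `ι : S → M`: the orthogonal complement of
its tangent space in the tangent space of `M` at `ι q`. -/
def submanifoldNormalSpace (ι : S → M) (q : S) : Submodule ℝ (TangentSpace I (ι q)) :=
  (submanifoldTangentSpace I J ι q)ᗮ

/-- The submanifold given by an immersion `ι : S → M` is totally geodesic if its second fundamental
form vanishes. The latter is the normal component of `∇_v Y` for `v` tangent to the submanifold at
a point `q` and `Y` a smooth vector field on a neighbourhood of `ι q` in `M` that is tangent to
the submanifold at all points near `q`. -/
def IsTotallyGeodesic (ι : S → M) : Prop :=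
  ∀ (q : S) (Y : Π x : M, TangentSpace I x) (U : Set M), IsOpen U → ι q ∈ U →
    CMDiff[U] ∞ (T% Y) →
    (∀ᶠ s in nhds q, Y (ι s) ∈ submanifoldTangentSpace I J ι s) →
    ∀ v ∈ submanifoldTangentSpace I J ι q,
      leviCivita I M Y (ι q) v ∈ submanifoldTangentSpace I J ι q

end RiemannianGeometry

end

/-! Let `θ` be the pullback to `Σ` of the one-form `⟨X, ·⟩`. It vanishes at `q` exactly when `X(q)`
is normal. Where it vanishes, its derivative is `⟨∇_v X, w⟩` for tangent `v`, `w`, because the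
remaining term pairs `X` with `∇_v W` for a tangent field `W`, and `∇_v W` is tangent when `Σ` is
totally geodesic. So both sides of the equivalence are statements about the first jet of `θ`.

Total geodesy also makes the Christoffel symbols of `M` in directions of `Σ` those of the induced
metric, so the Killing equation of `X` restricts to the Killing equation of `θ` on `Σ`. A Killing
form is determined by its first jet at a point: its second derivative is linear in the first jet
(`norm_fderiv_fderiv_le_of_symm_fderiv`), so Grönwall's inequality along segments makes the jet
vanish near each of its zeros (`eventually_jet_eq_zero`). The zero set of the jet is therefore open;
it is closed by continuity, and connectedness of `Σ` finishes the proof.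

The computation takes place in charts where the immersion is an injective linear map `L`
(`IsSliceChart`), so `θ` and the metric become maps on an open subset of a vector space. -/

set_option maxSynthPendingDepth 3

/-! ### Unique continuation for Killing one-forms on a vector space -/

section UniqueContinuation

variable {F : Type*} [NormedAddCommGroup F] [NormedSpace ℝ F]

/-- If the symmetrized derivative of a one-form is `2 θ ∘ C`, then the whole second derivative of
`θ` is a linear expression in the first jet of `θ`. -/
theorem norm_fderiv_fderiv_le_of_symm_fderiv {θ : F → F →L[ℝ] ℝ} {C : F → F →L[ℝ] F →L[ℝ] F}
    {u : F} (hθ : ContDiffAt ℝ 2 θ u) (hC : DifferentiableAt ℝ C u)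
    (h : ∀ᶠ v in nhds u, ∀ a b, fderiv ℝ θ v a b + fderiv ℝ θ v b a = 2 * θ v (C v a b)) :
    ‖fderiv ℝ (fderiv ℝ θ) u‖
      ≤ 3 * (‖fderiv ℝ θ u‖ * ‖C u‖ + ‖θ u‖ * ‖fderiv ℝ C u‖) := by
  have hθ1 : DifferentiableAt ℝ θ u := hθ.differentiableAt (by norm_num)
  have hD : DifferentiableAt ℝ (fderiv ℝ θ) u :=
    (hθ.fderiv_right (m := 1) (by norm_num)).differentiableAt (by norm_num)
  have hsymm : ∀ k i, fderiv ℝ (fderiv ℝ θ) u k i = fderiv ℝ (fderiv ℝ θ) u i k := fun k i ↦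
    (hθ.isSymmSndFDerivAt (by simp)) k i
  -- `R k i j` is half the derivative in direction `k` of the right-hand side of `h`.
  let R : F → F → F → ℝ := fun k i j ↦ fderiv ℝ θ u k (C u i j) + θ u (fderiv ℝ C u k i j)
  have hR : ∀ k i j, fderiv ℝ (fderiv ℝ θ) u k i j + fderiv ℝ (fderiv ℝ θ) u k j i
      = 2 * R k i j := by
    intro k i j
    have h1 : ∀ a b, HasFDerivAt (fun v ↦ fderiv ℝ θ v a b)
        ((ContinuousLinearMap.apply ℝ ℝ b).comp
          ((ContinuousLinearMap.apply ℝ (F →L[ℝ] ℝ) a).comp (fderiv ℝ (fderiv ℝ θ) u))) u :=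
      fun a b ↦ ((ContinuousLinearMap.apply ℝ ℝ b).hasFDerivAt).comp u
        (((ContinuousLinearMap.apply ℝ (F →L[ℝ] ℝ) a).hasFDerivAt).comp u hD.hasFDerivAt)
    have h2 : HasFDerivAt (fun v ↦ C v i j)
        ((ContinuousLinearMap.apply ℝ F j).comp
          ((ContinuousLinearMap.apply ℝ (F →L[ℝ] F) i).comp (fderiv ℝ C u))) u :=
      ((ContinuousLinearMap.apply ℝ F j).hasFDerivAt).comp u
        (((ContinuousLinearMap.apply ℝ (F →L[ℝ] F) i).hasFDerivAt).comp u hC.hasFDerivAt)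
    have h3 := (hθ1.hasFDerivAt.clm_apply h2).const_mul (2 : ℝ)
    have h4 : (fun v ↦ fderiv ℝ θ v i j + fderiv ℝ θ v j i) =ᶠ[nhds u]
        fun v ↦ 2 * θ v (C v i j) := h.mono fun v hv ↦ hv i j
    have h5 := ((h1 i j).add (h1 j i)).unique (h3.congr_of_eventuallyEq h4)
    have h6 := congrArg (fun T : F →L[ℝ] ℝ ↦ T k) h5
    simp at h6
    simp only [R]
    linarith
  -- As in the Koszul formula: a trilinear form symmetric in its first two slots is recovered from
  -- its symmetrization in the last two by an alternating sum over permutations.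
  have key : ∀ k i j, fderiv ℝ (fderiv ℝ θ) u k i j = R k i j + R i k j - R j k i := by
    intro k i j
    have e1 := hR k i j
    have e2 := hR i k j
    have e3 := hR j k i
    rw [hsymm i k] at e2
    rw [hsymm j k, hsymm j i] at e3
    linarith
  set B := ‖fderiv ℝ θ u‖ * ‖C u‖ + ‖θ u‖ * ‖fderiv ℝ C u‖ with hB
  have hRb : ∀ k i j, |R k i j| ≤ B * ‖k‖ * ‖i‖ * ‖j‖ := by
    intro k i j
    have a1 : ‖fderiv ℝ θ u k (C u i j)‖ ≤ (‖fderiv ℝ θ u‖ * ‖k‖) * (‖C u‖ * ‖i‖ * ‖j‖) :=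
      (ContinuousLinearMap.le_opNorm₂ _ _ _).trans (by
        gcongr; exact ContinuousLinearMap.le_opNorm₂ _ _ _)
    have a2 : ‖θ u (fderiv ℝ C u k i j)‖ ≤ ‖θ u‖ * (‖fderiv ℝ C u‖ * ‖k‖ * ‖i‖ * ‖j‖) :=
      (ContinuousLinearMap.le_opNorm _ _).trans (by
        gcongr
        refine (ContinuousLinearMap.le_opNorm₂ _ _ _).trans ?_
        gcongr; exact ContinuousLinearMap.le_opNorm _ _)
    calc |R k i j| ≤ ‖fderiv ℝ θ u k (C u i j)‖ + ‖θ u (fderiv ℝ C u k i j)‖ := abs_add_le _ _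
      _ ≤ _ := add_le_add a1 a2
      _ = B * ‖k‖ * ‖i‖ * ‖j‖ := by rw [hB]; ring
  have hB0 : 0 ≤ B := by positivity
  refine ContinuousLinearMap.opNorm_le_bound _ (by positivity) fun k ↦ ?_
  refine ContinuousLinearMap.opNorm_le_bound _ (by positivity) fun i ↦ ?_
  refine ContinuousLinearMap.opNorm_le_bound _ (by positivity) fun j ↦ ?_
  rw [key, Real.norm_eq_abs]
  have b1 := abs_le.1 (hRb k i j)
  have b2 := abs_le.1 (hRb i k j)
  have b3 := abs_le.1 (hRb j k i)
  have c2 : B * ‖i‖ * ‖k‖ * ‖j‖ = B * ‖k‖ * ‖i‖ * ‖j‖ := by ring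
  have c3 : B * ‖j‖ * ‖k‖ * ‖i‖ = B * ‖k‖ * ‖i‖ * ‖j‖ := by ring
  rw [c2] at b2
  rw [c3] at b3
  have c4 : 3 * B * ‖k‖ * ‖i‖ * ‖j‖ = 3 * (B * ‖k‖ * ‖i‖ * ‖j‖) := by ring
  rw [c4, abs_le]
  constructor <;> linarith [b1.1, b1.2, b2.1, b2.2, b3.1, b3.2]

/-- Unique continuation for the first jet of a one-form whose symmetrized derivative is `2 θ ∘ C`:
the jet vanishes near every zero of the jet. -/
theorem eventually_jet_eq_zero {θ : F → F →L[ℝ] ℝ} {C : F → F →L[ℝ] F →L[ℝ] F} {V : Set F}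
    (hV : IsOpen V) (hθ : ContDiffOn ℝ 2 θ V) (hC : ContDiffOn ℝ 1 C V)
    (h : ∀ v ∈ V, ∀ a b, fderiv ℝ θ v a b + fderiv ℝ θ v b a = 2 * θ v (C v a b))
    {u₀ : F} (hu₀ : u₀ ∈ V) (h0 : θ u₀ = 0) (h1 : fderiv ℝ θ u₀ = 0) :
    ∀ᶠ u in nhds u₀, θ u = 0 ∧ fderiv ℝ θ u = 0 := by
  have hC0 : ContinuousAt C u₀ := (hC.continuousOn).continuousAt (hV.mem_nhds hu₀)
  have hC1 : ContinuousAt (fderiv ℝ C) u₀ :=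
    (hC.continuousOn_fderiv_of_isOpen hV le_rfl).continuousAt (hV.mem_nhds hu₀)
  have hb : ∀ᶠ u in nhds u₀, u ∈ V ∧ ‖C u‖ < ‖C u₀‖ + 1 ∧ ‖fderiv ℝ C u‖ < ‖fderiv ℝ C u₀‖ + 1 :=
    (hV.eventually_mem hu₀).and
      ((hC0.norm.eventually_lt_const (by simp)).and (hC1.norm.eventually_lt_const (by simp)))
  obtain ⟨r, hr, hball⟩ := Metric.eventually_nhds_iff_ball.1 hb
  -- On the ball, `K` dominates the factor in the second-derivative estimate; it is also at least
  -- `1`, which is what the `θ` component of `f'` needs in `e5`.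
  set K : ℝ := 3 * (‖C u₀‖ + 1 + (‖fderiv ℝ C u₀‖ + 1)) + 1 with hK
  refine Metric.eventually_nhds_iff_ball.2 ⟨r, hr, fun u hu ↦ ?_⟩
  let γ : ℝ → F := fun t ↦ u₀ + t • (u - u₀)
  have hγmem : ∀ t ∈ Set.Icc (0 : ℝ) 1, γ t ∈ Metric.ball u₀ r := by
    intro t ht
    rw [mem_ball_iff_norm] at hu ⊢
    simp only [γ, add_sub_cancel_left, norm_smul, Real.norm_eq_abs, abs_of_nonneg ht.1]
    exact (mul_le_of_le_one_left (norm_nonneg _) ht.2).trans_lt hu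
  have hγ : ∀ t, HasDerivAt γ (u - u₀) t := fun t ↦ by
    have := ((hasDerivAt_id t).smul_const (u - u₀)).const_add u₀
    rwa [one_smul] at this
  have hθt : ∀ x ∈ V, ContDiffAt ℝ 2 θ x := fun x hx ↦ hθ.contDiffAt (hV.mem_nhds hx)
  let f : ℝ → (F →L[ℝ] ℝ) × (F →L[ℝ] F →L[ℝ] ℝ) := fun t ↦ (θ (γ t), fderiv ℝ θ (γ t))
  let f' : ℝ → (F →L[ℝ] ℝ) × (F →L[ℝ] F →L[ℝ] ℝ) := fun t ↦
    (fderiv ℝ θ (γ t) (u - u₀), fderiv ℝ (fderiv ℝ θ) (γ t) (u - u₀))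
  have hf : ∀ t ∈ Set.Icc (0 : ℝ) 1, HasDerivAt f (f' t) t := by
    intro t ht
    have hx := hθt _ (hball _ (hγmem t ht)).1
    have d1 : DifferentiableAt ℝ θ (γ t) := hx.differentiableAt (by norm_num)
    have d2 : DifferentiableAt ℝ (fderiv ℝ θ) (γ t) :=
      (hx.fderiv_right (m := 1) (by norm_num)).differentiableAt (by norm_num)
    exact (d1.hasFDerivAt.comp_hasDerivAt t (hγ t)).prodMk
      (d2.hasFDerivAt.comp_hasDerivAt t (hγ t))
  have hbound : ∀ t ∈ Set.Icc (0 : ℝ) 1, ‖f' t‖ ≤ (K * ‖u - u₀‖) * ‖f t‖ := by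
    intro t ht
    obtain ⟨hxV, hxC, hxD⟩ := hball _ (hγmem t ht)
    have e1 : ‖θ (γ t)‖ ≤ ‖f t‖ := norm_fst_le (f t)
    have e2 : ‖fderiv ℝ θ (γ t)‖ ≤ ‖f t‖ := norm_snd_le (f t)
    have e3 := norm_fderiv_fderiv_le_of_symm_fderiv (hθt _ hxV)
      ((hC.contDiffAt (hV.mem_nhds hxV)).differentiableAt (by norm_num))
      ((hV.eventually_mem hxV).mono h)
    have e4 : ‖fderiv ℝ (fderiv ℝ θ) (γ t)‖ ≤ K * ‖f t‖ := by
      have : ‖fderiv ℝ θ (γ t)‖ * ‖C (γ t)‖ + ‖θ (γ t)‖ * ‖fderiv ℝ C (γ t)‖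
          ≤ ‖f t‖ * (‖C u₀‖ + 1) + ‖f t‖ * (‖fderiv ℝ C u₀‖ + 1) := by gcongr
      nlinarith [norm_nonneg (f t)]
    have e5 : ‖fderiv ℝ θ (γ t)‖ ≤ K * ‖f t‖ := by
      refine e2.trans (le_mul_of_one_le_left (norm_nonneg _) ?_)
      have := norm_nonneg (C u₀)
      have := norm_nonneg (fderiv ℝ C u₀)
      linarith
    refine norm_prod_le_iff.2 ⟨?_, ?_⟩
    · calc _ ≤ _ := ContinuousLinearMap.le_opNorm _ _
        _ ≤ (K * ‖f t‖) * ‖u - u₀‖ := by gcongr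
        _ = _ := by ring
    · calc _ ≤ _ := ContinuousLinearMap.le_opNorm _ _
        _ ≤ (K * ‖f t‖) * ‖u - u₀‖ := by gcongr
        _ = _ := by ring
  -- Grönwall for the jet `f` along the segment from `u₀` to `u`: it starts at `0` and satisfies
  -- `‖f'‖ ≤ const * ‖f‖`.
  have hz := eq_zero_of_abs_deriv_le_mul_abs_self_of_eq_zero_right
    (fun t ht ↦ (hf t ht).continuousAt.continuousWithinAt)
    (fun t ht ↦ (hf t (Set.Ico_subset_Icc_self ht)).hasDerivWithinAt)
    (by simp [f, γ, h0, h1]) (fun t ht ↦ hbound t (Set.Ico_subset_Icc_self ht))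
    1 (by simp)
  simpa [f, γ] using hz

/-- Unique continuation for the first jet of a one-form `θ` satisfying the Killing equation of the
metric `g`: the symmetrized derivative of `θ` is `2 θ ∘ Γ`, where `Γ` are the Christoffel symbols
of `g`. -/
theorem eventually_jet_eq_zero_of_killing [FiniteDimensional ℝ F]
    {θ : F → F →L[ℝ] ℝ} {g : F → F →L[ℝ] F →L[ℝ] ℝ} {V : Set F}
    (hV : IsOpen V) (hθ : ContDiffOn ℝ 2 θ V) (hg : ContDiffOn ℝ 2 g V)
    (hpos : ∀ v ∈ V, ∀ a, g v a a = 0 → a = 0)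
    (h : ∀ v ∈ V, ∀ a b, ∃ c,
      (∀ d, 2 * g v c d = fderiv ℝ g v a b d + fderiv ℝ g v b a d - fderiv ℝ g v d a b) ∧
      fderiv ℝ θ v a b + fderiv ℝ θ v b a = 2 * θ v c)
    {u₀ : F} (hu₀ : u₀ ∈ V) (h0 : θ u₀ = 0) (h1 : fderiv ℝ θ u₀ = 0) :
    ∀ᶠ u in nhds u₀, θ u = 0 ∧ fderiv ℝ θ u = 0 := by
  have : CompleteSpace F := FiniteDimensional.complete ℝ F
  have hinj : ∀ v ∈ V, Function.Injective (g v) := fun v hv ↦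
    (injective_iff_map_eq_zero (g v)).2 fun a ha ↦ hpos v hv a (by simp [ha])
  -- Nondegeneracy and equality of dimensions make `g v` invertible, so that an index can be raised
  -- in a `C¹` way.
  have hinv : ∀ v ∈ V, ∃ e : F ≃L[ℝ] (F →L[ℝ] ℝ), (e : F →L[ℝ] (F →L[ℝ] ℝ)) = g v := by
    intro v hv
    have hfr : Module.finrank ℝ F = Module.finrank ℝ (F →L[ℝ] ℝ) := by
      rw [← (LinearMap.toContinuousLinearMap (𝕜 := ℝ) (E := F) (F' := ℝ)).finrank_eq]
      exact (Subspace.dual_finrank_eq (K := ℝ) (V := F)).symm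
    refine ⟨(LinearEquiv.ofInjectiveOfFinrankEq (g v).toLinearMap (hinj v hv)
      hfr).toContinuousLinearEquiv, ?_⟩
    ext a b
    rfl
  let flipL := (ContinuousLinearMap.flipₗᵢ ℝ F F ℝ).toContinuousLinearEquiv.toContinuousLinearMap
  -- Christoffel symbols of the first kind; `flipL` moves the direction of differentiation into the
  -- last slot. Composing with the inverse of `g v` gives the symbols of the second kind, `C`.
  let K : F → F →L[ℝ] F →L[ℝ] F →L[ℝ] ℝ := fun v ↦ (1 / 2 : ℝ) •
    (fderiv ℝ g v + (fderiv ℝ g v).flip - flipL.comp (fderiv ℝ g v).flip)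
  have hK : ContDiffOn ℝ 1 K V := by
    have hd : ContDiffOn ℝ 1 (fderiv ℝ g) V := hg.fderiv_of_isOpen hV (by norm_num)
    have hf : ContDiffOn ℝ 1 (fun v ↦ (fderiv ℝ g v).flip) V :=
      (ContinuousLinearMap.flipₗᵢ ℝ F F (F →L[ℝ] ℝ)).contDiff.comp_contDiffOn hd
    exact ((hd.add hf).sub (contDiffOn_const.clm_comp hf)).const_smul (1 / 2 : ℝ)
  let C : F → F →L[ℝ] F →L[ℝ] F := fun v ↦
    (ContinuousLinearMap.compL ℝ F (F →L[ℝ] ℝ) F (g v).inverse).comp (K v)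
  have hC : ContDiffOn ℝ 1 C V := by
    have hi : ContDiffOn ℝ 1 (fun v ↦ (g v).inverse) V := by
      intro v hv
      obtain ⟨e, he⟩ := hinv v hv
      have := contDiffAt_map_inverse (𝕜 := ℝ) (n := 1) e
      rw [he] at this
      exact this.comp_contDiffWithinAt v ((hg v hv).of_le (by norm_num))
    exact ((ContinuousLinearMap.contDiff _).comp_contDiffOn hi).clm_comp hK
  refine eventually_jet_eq_zero hV hθ hC (fun v hv a b ↦ ?_) hu₀ h0 h1
  obtain ⟨c, hc, hc'⟩ := h v hv a b
  rw [hc']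
  congr 2
  -- The hypothesis only provides `c` for each `v`, `a`, `b` separately; nondegeneracy forces it to
  -- be `C v a b`, which is differentiable in `v`.
  have hcK : g v c = K v a b := by
    ext d
    have := hc d
    simp [K, flipL, ContinuousLinearMap.flip_apply] 
    linarith
  obtain ⟨e, he⟩ := hinv v hv
  change c = (g v).inverse (K v a b)
  rw [← hcK, ← he]
  simp

end UniqueContinuation

noncomputable section

namespace RiemannianGeometry

/-! ### Coordinate vector fields of a chart -/

section CoordinateFields

variable {E : Type*} [NormedAddCommGroup E] [NormedSpace ℝ E]
  {M : Type*} [TopologicalSpace M] [ChartedSpace E M]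

/-- The constant vector field on a normed space with value `e`. -/
def constField (e : E) : Π y : E, TangentSpace 𝓘(ℝ, E) y := fun _ ↦ e

theorem contMDiff_constField (e : E) : CMDiff ∞ (T% (constField e)) := by
  intro y
  refine (Bundle.contMDiffAt_section (s := constField e) y).2 ?_
  simpa using! contMDiffAt_const

theorem mlieBracket_constField (e e' : E) :
    VectorField.mlieBracket 𝓘(ℝ, E) (constField e) (constField e') = 0 := by
  have h : VectorField.lieBracketWithin ℝ (fun _ : E ↦ e) (fun _ : E ↦ e') Set.univ = 0 := by
    ext y
    simp [VectorField.lieBracket_eq]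
  rw [← VectorField.mlieBracketWithin_univ]
  exact VectorField.mlieBracketWithin_eq_lieBracketWithin.trans h

/-- The coordinate vector field of a chart `φ` associated to a direction `e` in the model space. -/
def coordField (φ : OpenPartialHomeomorph M E) (e : E) : Π x : M, TangentSpace 𝓘(ℝ, E) x :=
  VectorField.mpullback 𝓘(ℝ, E) 𝓘(ℝ, E) φ (constField e)

variable [IsManifold 𝓘(ℝ, E) ∞ M] {φ : OpenPartialHomeomorph M E}

theorem mdifferentiable_of_mem_maximalAtlas (hφ : φ ∈ IsManifold.maximalAtlas 𝓘(ℝ, E) ∞ M) :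
    φ.MDifferentiable 𝓘(ℝ, E) 𝓘(ℝ, E) :=
  ⟨(contMDiffOn_of_mem_maximalAtlas hφ).mdifferentiableOn (by simp),
    (contMDiffOn_symm_of_mem_maximalAtlas hφ).mdifferentiableOn (by simp)⟩

theorem coordField_symm_apply (hφ : φ ∈ IsManifold.maximalAtlas 𝓘(ℝ, E) ∞ M) {y : E}
    (hy : y ∈ φ.target) (e : E) :
    coordField φ e (φ.symm y) = mfderiv 𝓘(ℝ, E) 𝓘(ℝ, E) φ.symm y (constField e y) := by
  have h := mdifferentiable_of_mem_maximalAtlas hφ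
  have h1 := h.symm_comp_deriv (φ.map_target hy)
  have h2 := h.comp_symm_deriv hy
  rw [φ.right_inv hy] at h1
  rw [coordField, VectorField.mpullback_apply]
  have h3 := congrArg (fun T ↦ T (constField e y)) (ContinuousLinearMap.inverse_eq h2 h1)
  exact h3

theorem eq_zero_of_coordField_eq_zero (hφ : φ ∈ IsManifold.maximalAtlas 𝓘(ℝ, E) ∞ M) {y : E}
    (hy : y ∈ φ.target) {e : E} (he : coordField φ e (φ.symm y) = 0) : e = 0 := by
  rw [coordField_symm_apply hφ hy] at he
  have h2 := (mdifferentiable_of_mem_maximalAtlas hφ).comp_symm_deriv hy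
  have h3 := congrArg (fun T ↦ T (constField e y)) h2
  simp only [ContinuousLinearMap.comp_apply, he] at h3
  exact h3.symm.trans (map_zero _)

theorem coordField_add (e e' : E) : coordField φ (e + e') = coordField φ e + coordField φ e' :=
  VectorField.mpullback_add

theorem coordField_smul (c : ℝ) (e : E) : coordField φ (c • e) = c • coordField φ e :=
  VectorField.mpullback_const_smul

theorem contMDiffOn_coordField [CompleteSpace E]
    (hφ : φ ∈ IsManifold.maximalAtlas 𝓘(ℝ, E) ∞ M) (e : E) :
    CMDiff[φ.source] ∞ (T% (coordField φ e)) := by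
  intro x hx
  have hinv : (mfderiv 𝓘(ℝ, E) 𝓘(ℝ, E) φ x).IsInvertible :=
    ⟨(mdifferentiable_of_mem_maximalAtlas hφ).mfderiv hx, rfl⟩
  exact (ContMDiffAt.mpullback_vectorField_preimage (contMDiff_constField e (φ x))
    (contMDiffAt_of_mem_maximalAtlas hφ hx) hinv (by simp)).contMDiffWithinAt

theorem mdiffAt_coordField [CompleteSpace E]
    (hφ : φ ∈ IsManifold.maximalAtlas 𝓘(ℝ, E) ∞ M) (e : E) {x : M} (hx : x ∈ φ.source) :
    MDiffAt (T% (coordField φ e)) x :=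
  ((contMDiffOn_coordField hφ e).contMDiffAt (φ.open_source.mem_nhds hx)).mdifferentiableAt
    (by simp)

/-- Lie brackets commute with pullback along the chart, and constant fields commute. -/
theorem mlieBracket_coordField [CompleteSpace E]
    (hφ : φ ∈ IsManifold.maximalAtlas 𝓘(ℝ, E) ∞ M) (e e' : E) {x : M} (hx : x ∈ φ.source) :
    VectorField.mlieBracket 𝓘(ℝ, E) (coordField φ e) (coordField φ e') x = 0 := by
  have hc : ∀ e : E, MDiffAt (T% (constField e)) (φ x) := fun e ↦
    (contMDiff_constField e (φ x)).mdifferentiableAt (by simp)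
  have : IsManifold 𝓘(ℝ, E) (minSmoothness ℝ 3) M := by
    rw [minSmoothness_of_isRCLikeNormedField]; infer_instance
  rw [coordField, coordField, ← VectorField.mpullback_mlieBracket (hc e) (hc e')
    (contMDiffAt_of_mem_maximalAtlas hφ hx) 
    (by rw [minSmoothness_of_isRCLikeNormedField]; exact ENat.LEInfty.out),
    VectorField.mpullback_apply, mlieBracket_constField, Pi.zero_apply, map_zero]

/-- Passes from intrinsic derivatives along coordinate fields to ordinary partial derivatives, by
the chain rule. -/
theorem mvfderiv_coordField (hφ : φ ∈ IsManifold.maximalAtlas 𝓘(ℝ, E) ∞ M) {y : E}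
    (hy : y ∈ φ.target) (e : E) {h : M → ℝ} (hh : MDiffAt h (φ.symm y)) :
    d% h (φ.symm y) (coordField φ e (φ.symm y)) = fderiv ℝ (h ∘ φ.symm) y e := by
  have hs := (mdifferentiable_of_mem_maximalAtlas hφ).mdifferentiableAt_symm hy
  rw [← mfderiv_eq_fderiv, mfderiv_comp y hh hs, coordField_symm_apply hφ hy]
  rfl

end CoordinateFields

/-! ### Skew-symmetry of the covariant derivative of a Killing field -/

section Killing

variable {E : Type*} [NormedAddCommGroup E] [NormedSpace ℝ E] [FiniteDimensional ℝ E]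
  {H : Type*} [TopologicalSpace H] {I : ModelWithCorners ℝ E H}
  {M : Type*} [TopologicalSpace M] [ChartedSpace H M] [IsManifold I ∞ M]
  [RiemannianBundle (fun x : M ↦ TangentSpace I x)]
  [IsContMDiffRiemannianBundle I ∞ E (fun x : M ↦ TangentSpace I x)]

theorem contMDiffOn_inner {X Y : Π x : M, TangentSpace I x} {U : Set M}
    (hX : CMDiff[U] ∞ (T% X)) (hY : CMDiff[U] ∞ (T% Y)) :
    CMDiff[U] ∞ (fun y : M ↦ (inner ℝ (X y) (Y y) : ℝ)) :=
  ContMDiffOn.inner_bundle (E := fun x : M ↦ TangentSpace I x) hX hY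

/-- The covariant derivative of a Killing field is skew-symmetric. -/
theorem IsKillingField.inner_leviCivita {X Y Z : Π x : M, TangentSpace I x} {U : Set M}
    (hX : IsKillingField X) (hU : IsOpen U) (hY : CMDiff[U] ∞ (T% Y)) (hZ : CMDiff[U] ∞ (T% Z))
    {x : M} (hx : x ∈ U) :
    (inner ℝ (leviCivita I M X x (Y x)) (Z x) : ℝ)
      + inner ℝ (Y x) (leviCivita I M X x (Z x)) = 0 := by
  have dX : MDiffAt (T% X) x := (hX.contMDiff x).mdifferentiableAt (by simp)
  have dY : MDiffAt (T% Y) x := (hY.contMDiffAt (hU.mem_nhds hx)).mdifferentiableAt (by simp)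
  have dZ : MDiffAt (T% Z) x := (hZ.contMDiffAt (hU.mem_nhds hx)).mdifferentiableAt (by simp)
  have h := hX.lieDeriv_metric Y Z U hU hY hZ x hx
  -- Writing `[X, Y] = ∇_X Y - ∇_Y X`, the `∇_X` terms cancel against metric compatibility.
  rw [leviCivita_metric dX dY dZ, ← leviCivita_torsionFree dX dY, ← leviCivita_torsionFree dX dZ,
    inner_sub_left, inner_sub_right] at h
  linarith

end Killing

/-! ### The one-form and the metric on a linear slice -/

section PullbackForm

variable {E : Type*} [NormedAddCommGroup E] [NormedSpace ℝ E] [FiniteDimensional ℝ E]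
  {M : Type*} [TopologicalSpace M] [ChartedSpace E M] [IsManifold 𝓘(ℝ, E) ∞ M]
  [RiemannianBundle (fun x : M ↦ TangentSpace 𝓘(ℝ, E) x)]
  [IsContMDiffRiemannianBundle 𝓘(ℝ, E) ∞ E (fun x : M ↦ TangentSpace 𝓘(ℝ, E) x)]
  {F : Type*} [NormedAddCommGroup F] [NormedSpace ℝ F] [FiniteDimensional ℝ F]

/-- The pullback of the one-form `⟨X, ·⟩` under the map which in the chart `φ` is the linear
map `L`. -/
def pullbackForm (φ : OpenPartialHomeomorph M E) (L : F →L[ℝ] E)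
    (X : Π x : M, TangentSpace 𝓘(ℝ, E) x) (u : F) : F →L[ℝ] ℝ :=
  LinearMap.toContinuousLinearMap
    { toFun := fun a ↦ inner ℝ (X (φ.symm (L u))) (coordField φ (L a) (φ.symm (L u)))
      map_add' := fun a b ↦ by simp [coordField_add, inner_add_right]
      map_smul' := fun c a ↦ by simp [coordField_smul, real_inner_smul_right] }

theorem pullbackForm_apply (φ : OpenPartialHomeomorph M E) (L : F →L[ℝ] E)
    (X : Π x : M, TangentSpace 𝓘(ℝ, E) x) (u a : F) :
    pullbackForm φ L X u a = inner ℝ (X (φ.symm (L u))) (coordField φ (L a) (φ.symm (L u))) :=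
  rfl

/-- The pullback of the metric under the map which in the chart `φ` is the linear map `L`. -/
def pullbackMetric (φ : OpenPartialHomeomorph M E) (L : F →L[ℝ] E) (u : F) : F →L[ℝ] F →L[ℝ] ℝ :=
  LinearMap.toContinuousLinearMap
    { toFun := fun a ↦ pullbackForm φ L (coordField φ (L a)) u
      map_add' := fun a b ↦ by
        ext c; simp [pullbackForm_apply, coordField_add, inner_add_left]
      map_smul' := fun c a ↦ by
        ext d; simp [pullbackForm_apply, coordField_smul, real_inner_smul_left] }

theorem pullbackMetric_apply (φ : OpenPartialHomeomorph M E) (L : F →L[ℝ] E) (u a : F) :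
    pullbackMetric φ L u a = pullbackForm φ L (coordField φ (L a)) u :=
  rfl

variable {φ : OpenPartialHomeomorph M E} {L : F →L[ℝ] E} {V : Set F}
  {X : Π x : M, TangentSpace 𝓘(ℝ, E) x}

theorem contDiffOn_inner_comp_symm (hφ : φ ∈ IsManifold.maximalAtlas 𝓘(ℝ, E) ∞ M)
    {Y : Π x : M, TangentSpace 𝓘(ℝ, E) x}
    (hX : CMDiff[φ.source] ∞ (T% X)) (hY : CMDiff[φ.source] ∞ (T% Y)) :
    ContDiffOn ℝ ∞ ((fun y : M ↦ (inner ℝ (X y) (Y y) : ℝ)) ∘ φ.symm) φ.target :=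
  contMDiffOn_iff_contDiffOn.1 ((contMDiffOn_inner hX hY).comp
    (contMDiffOn_symm_of_mem_maximalAtlas hφ) φ.mapsTo_symm)

theorem contDiffOn_pullbackForm (hφ : φ ∈ IsManifold.maximalAtlas 𝓘(ℝ, E) ∞ M)
    (hX : CMDiff[φ.source] ∞ (T% X)) (hV : Set.MapsTo L V φ.target) :
    ContDiffOn ℝ ∞ (pullbackForm φ L X) V := by
  rw [contDiffOn_clm_apply]
  intro a
  exact (contDiffOn_inner_comp_symm hφ hX (contMDiffOn_coordField hφ (L a))).comp
    L.contDiff.contDiffOn hV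

theorem contDiffOn_pullbackMetric (hφ : φ ∈ IsManifold.maximalAtlas 𝓘(ℝ, E) ∞ M)
    (hV : Set.MapsTo L V φ.target) : ContDiffOn ℝ ∞ (pullbackMetric φ L) V := by
  rw [contDiffOn_clm_apply]
  exact fun a ↦ contDiffOn_pullbackForm hφ (contMDiffOn_coordField hφ (L a)) hV

/-- Metric compatibility along the coordinate field of `L b`. The free point `x` allows `x = ι s`
without rewriting inside dependent types. -/
theorem fderiv_pullbackForm (hφ : φ ∈ IsManifold.maximalAtlas 𝓘(ℝ, E) ∞ M)
    (hX : CMDiff[φ.source] ∞ (T% X)) {u : F} (hu : L u ∈ φ.target) {x : M}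
    (hx : φ.symm (L u) = x) (a b : F) :
    fderiv ℝ (pullbackForm φ L X) u b a
      = inner ℝ (leviCivita 𝓘(ℝ, E) M X x (coordField φ (L b) x)) (coordField φ (L a) x)
        + inner ℝ (X x)
          (leviCivita 𝓘(ℝ, E) M (coordField φ (L a)) x (coordField φ (L b) x)) := by
  subst hx
  have hs : φ.symm (L u) ∈ φ.source := φ.map_target hu
  have dX : MDiffAt (T% X) (φ.symm (L u)) :=
    (hX.contMDiffAt (φ.open_source.mem_nhds hs)).mdifferentiableAt (by simp)
  have da := mdiffAt_coordField hφ (L a) hs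
  have db := mdiffAt_coordField hφ (L b) hs
  rw [← leviCivita_metric db dX da, mvfderiv_coordField hφ hu (L b) (mdiffAt_inner dX da)]
  have hopen : IsOpen (L ⁻¹' φ.target) := φ.open_target.preimage L.continuous
  have hd : DifferentiableAt ℝ (pullbackForm φ L X) u :=
    ((contDiffOn_pullbackForm hφ hX (Set.mapsTo_preimage L φ.target)).contDiffAt
      (hopen.mem_nhds hu)).differentiableAt (by simp)
  have hh : DifferentiableAt ℝ ((fun y : M ↦ (inner ℝ (X y) (coordField φ (L a) y) : ℝ)) ∘ φ.symm)
      (L u) :=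
    ((contDiffOn_inner_comp_symm hφ hX (contMDiffOn_coordField hφ (L a))).contDiffAt
      (φ.open_target.mem_nhds hu)).differentiableAt (by simp)
  have h1 : HasFDerivAt (fun v ↦ pullbackForm φ L X v a) _ u :=
    hd.hasFDerivAt.clm_apply (hasFDerivAt_const a u)
  have h2 := h1.unique (hh.hasFDerivAt.comp u L.hasFDerivAt)
  simpa using congrArg (fun T : F →L[ℝ] ℝ ↦ T b) h2

/-- The metric with its first slot fixed is the pullback form of a coordinate field, so the previous
formula applies. -/
theorem fderiv_pullbackMetric (hφ : φ ∈ IsManifold.maximalAtlas 𝓘(ℝ, E) ∞ M)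
    {u : F} (hu : L u ∈ φ.target) {x : M} (hx : φ.symm (L u) = x) (a b c : F) :
    fderiv ℝ (pullbackMetric φ L) u c a b
      = inner ℝ (leviCivita 𝓘(ℝ, E) M (coordField φ (L a)) x (coordField φ (L c) x))
          (coordField φ (L b) x)
        + inner ℝ (coordField φ (L a) x)
          (leviCivita 𝓘(ℝ, E) M (coordField φ (L b)) x (coordField φ (L c) x)) := by
  rw [← fderiv_pullbackForm hφ (contMDiffOn_coordField hφ (L a)) hu hx]
  have hopen : IsOpen (L ⁻¹' φ.target) := φ.open_target.preimage L.continuous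
  have hd : DifferentiableAt ℝ (pullbackMetric φ L) u :=
    ((contDiffOn_pullbackMetric hφ (Set.mapsTo_preimage L φ.target)).contDiffAt
      (hopen.mem_nhds hu)).differentiableAt (by simp)
  have h1 : HasFDerivAt (pullbackForm φ L (coordField φ (L a))) _ u :=
    hd.hasFDerivAt.clm_apply (hasFDerivAt_const a u)
  rw [h1.fderiv]
  simp

theorem leviCivita_coordField_comm (hφ : φ ∈ IsManifold.maximalAtlas 𝓘(ℝ, E) ∞ M)
    {x : M} (hx : x ∈ φ.source) (e e' : E) :
    leviCivita 𝓘(ℝ, E) M (coordField φ e) x (coordField φ e' x)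
      = leviCivita 𝓘(ℝ, E) M (coordField φ e') x (coordField φ e x) := by
  have h := leviCivita_torsionFree (mdiffAt_coordField hφ e' hx) (mdiffAt_coordField hφ e hx)
  rw [mlieBracket_coordField hφ _ _ hx] at h
  exact sub_eq_zero.1 h

/-- The Christoffel symbols of the first kind in a chart. -/
theorem two_mul_inner_leviCivita_coordField (hφ : φ ∈ IsManifold.maximalAtlas 𝓘(ℝ, E) ∞ M)
    {u : F} (hu : L u ∈ φ.target) {x : M} (hx : φ.symm (L u) = x) (a b d : F) :
    2 * (inner ℝ (leviCivita 𝓘(ℝ, E) M (coordField φ (L b)) x (coordField φ (L a) x))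
        (coordField φ (L d) x) : ℝ)
      = fderiv ℝ (pullbackMetric φ L) u a b d + fderiv ℝ (pullbackMetric φ L) u b a d
        - fderiv ℝ (pullbackMetric φ L) u d a b := by
  have hs : x ∈ φ.source := hx ▸ φ.map_target hu
  simp only [fderiv_pullbackMetric hφ hu hx]
  -- Torsion-freeness pairs the six terms of the expansion: four cancel and the other two agree.
  rw [leviCivita_coordField_comm hφ hs (L d) (L a), leviCivita_coordField_comm hφ hs (L d) (L b),
    leviCivita_coordField_comm hφ hs (L b) (L a), real_inner_comm (coordField φ (L b) x)]
  ring

end PullbackForm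

/-! ### Slice charts of an immersion -/

section Immersion

variable {E : Type*} [NormedAddCommGroup E] [NormedSpace ℝ E]
  {M : Type*} [TopologicalSpace M] [ChartedSpace E M]
  {F : Type*} [NormedAddCommGroup F] [NormedSpace ℝ F]
  {S : Type*} [TopologicalSpace S] [ChartedSpace F S]

/-- Charts `ψ` of `S` and `φ` of `M` in which `ι : S → M` is the injective linear map `L`. -/
structure IsSliceChart (ι : S → M) (ψ : OpenPartialHomeomorph S F)
    (φ : OpenPartialHomeomorph M E) (L : F →L[ℝ] E) : Prop where
  mem_left : ψ ∈ IsManifold.maximalAtlas 𝓘(ℝ, F) ∞ S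
  mem_right : φ ∈ IsManifold.maximalAtlas 𝓘(ℝ, E) ∞ M
  injective : Function.Injective L
  mapsTo : Set.MapsTo ι ψ.source φ.source
  apply_eq : ∀ s ∈ ψ.source, φ (ι s) = L (ψ s)

/-- In the normal form `u ↦ (u, 0)` of an immersion, the identification of the product with `E` is
linear, so it can be absorbed into `L`. -/
theorem exists_isSliceChart {ι : S → M} (hι : Manifold.IsImmersion 𝓘(ℝ, F) 𝓘(ℝ, E) ∞ ι) (q : S) :
    ∃ (ψ : OpenPartialHomeomorph S F) (φ : OpenPartialHomeomorph M E) (L : F →L[ℝ] E),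
      q ∈ ψ.source ∧ IsSliceChart ι ψ φ L := by
  have h := (hι.isImmersionAt q).isImmersionAtOfComplement_complement
  refine ⟨h.domChart, h.codChart, h.equiv.toContinuousLinearMap.comp (.inl ℝ F _),
    h.mem_domChart_source, h.domChart_mem_maximalAtlas, h.codChart_mem_maximalAtlas,
    h.equiv.injective.comp (Prod.mk_left_injective 0), h.source_subset_preimage_source,
    fun s hs ↦ ?_⟩
  have hs' : h.domChart s ∈ (h.domChart.extend 𝓘(ℝ, F)).target := by
    simpa using h.domChart.map_source hs
  simpa [h.domChart.left_inv hs] using h.writtenInCharts hs'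

namespace IsSliceChart

variable {ι : S → M} {ψ : OpenPartialHomeomorph S F} {φ : OpenPartialHomeomorph M E}
  {L : F →L[ℝ] E}

theorem symm_apply (h : IsSliceChart ι ψ φ L) {s : S} (hs : s ∈ ψ.source) :
    φ.symm (L (ψ s)) = ι s := by
  rw [← h.apply_eq s hs, φ.left_inv (h.mapsTo hs)]

theorem map_mem_target (h : IsSliceChart ι ψ φ L) {s : S} (hs : s ∈ ψ.source) :
    L (ψ s) ∈ φ.target := by
  rw [← h.apply_eq s hs]
  exact φ.map_source (h.mapsTo hs)

theorem mapsTo_target (h : IsSliceChart ι ψ φ L) : Set.MapsTo L ψ.target φ.target := by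
  intro u hu
  have := h.map_mem_target (ψ.map_target hu)
  rwa [ψ.right_inv hu] at this

variable [IsManifold 𝓘(ℝ, E) ∞ M] [IsManifold 𝓘(ℝ, F) ∞ S]

/-- In slice charts, the tangent space of the submanifold is spanned by the coordinate fields. -/
theorem mem_submanifoldTangentSpace (h : IsSliceChart ι ψ φ L) {s : S} (hs : s ∈ ψ.source)
    {v : TangentSpace 𝓘(ℝ, E) (ι s)} :
    v ∈ submanifoldTangentSpace 𝓘(ℝ, E) 𝓘(ℝ, F) ι s ↔ ∃ a, coordField φ (L a) (ι s) = v := by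
  have hφ := mdifferentiable_of_mem_maximalAtlas h.mem_right
  have hψ := mdifferentiable_of_mem_maximalAtlas h.mem_left
  have hev : φ ∘ ι =ᶠ[nhds s] L ∘ ψ :=
    Filter.eventuallyEq_of_mem (ψ.open_source.mem_nhds hs) h.apply_eq
  have dL : ∀ u, MDifferentiableAt 𝓘(ℝ, F) 𝓘(ℝ, E) L u := fun u ↦
    L.differentiableAt.mdifferentiableAt
  have dι : MDifferentiableAt 𝓘(ℝ, F) 𝓘(ℝ, E) ι s := by
    have hc := (hφ.mdifferentiableAt_symm (h.map_mem_target hs)).comp s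
      ((dL (ψ s)).comp s (hψ.mdifferentiableAt hs))
    exact hc.congr_of_eventuallyEq (Filter.eventuallyEq_of_mem (ψ.open_source.mem_nhds hs)
      fun t ht ↦ (h.symm_apply ht).symm)
  -- The chain rule on both sides of `φ ∘ ι = L ∘ ψ`.
  have hd : ∀ w, mfderiv 𝓘(ℝ, E) 𝓘(ℝ, E) φ (ι s) (mfderiv 𝓘(ℝ, F) 𝓘(ℝ, E) ι s w)
      = constField (L (mfderiv 𝓘(ℝ, F) 𝓘(ℝ, F) ψ s w)) (φ (ι s)) := by
    intro w
    have h1 := mfderiv_comp s (hφ.mdifferentiableAt (h.mapsTo hs)) dι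
    have h2 := mfderiv_comp s (dL (ψ s)) (hψ.mdifferentiableAt hs)
    have h3 := hev.mfderiv_eq (I := 𝓘(ℝ, F)) (I' := 𝓘(ℝ, E))
    rw [h1] at h3
    have h4 := congrArg (fun T ↦ T w) (h3.trans h2)
    rw [mfderiv_eq_fderiv, L.fderiv] at h4
    exact h4
  have key : ∀ w, coordField φ (L (mfderiv 𝓘(ℝ, F) 𝓘(ℝ, F) ψ s w)) (ι s)
      = mfderiv 𝓘(ℝ, F) 𝓘(ℝ, E) ι s w := by
    intro w
    rw [coordField, VectorField.mpullback_apply, ← hd w]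
    exact congrArg (fun T ↦ T (mfderiv 𝓘(ℝ, F) 𝓘(ℝ, E) ι s w))
      (ContinuousLinearMap.IsInvertible.inverse_comp_self
        (f := mfderiv 𝓘(ℝ, E) 𝓘(ℝ, E) φ (ι s)) ⟨hφ.mfderiv (h.mapsTo hs), rfl⟩)
  constructor
  · rintro ⟨w, rfl⟩
    exact ⟨_, key w⟩
  · rintro ⟨a, rfl⟩
    obtain ⟨w, rfl⟩ := hψ.mfderiv_surjective hs (constField a (ψ s))
    exact ⟨w, (key w).symm⟩

end IsSliceChart

end Immersion

/-! ### The first jet of the pullback form along the submanifold -/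

section Submanifold

variable {E : Type*} [NormedAddCommGroup E] [NormedSpace ℝ E] [FiniteDimensional ℝ E]
  {M : Type*} [TopologicalSpace M] [ChartedSpace E M] [IsManifold 𝓘(ℝ, E) ∞ M]
  [RiemannianBundle (fun x : M ↦ TangentSpace 𝓘(ℝ, E) x)]
  [IsContMDiffRiemannianBundle 𝓘(ℝ, E) ∞ E (fun x : M ↦ TangentSpace 𝓘(ℝ, E) x)]
  {F : Type*} [NormedAddCommGroup F] [NormedSpace ℝ F] [FiniteDimensional ℝ F]
  {S : Type*} [TopologicalSpace S] [ChartedSpace F S] [IsManifold 𝓘(ℝ, F) ∞ S]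
  {ι : S → M} {ψ : OpenPartialHomeomorph S F} {φ : OpenPartialHomeomorph M E} {L : F →L[ℝ] E}
  {X : Π x : M, TangentSpace 𝓘(ℝ, E) x}

/-- The coordinate field of `L a` is tangent to the submanifold throughout the slice, hence a
legitimate test field in the definition of total geodesy. -/
theorem IsSliceChart.leviCivita_coordField_mem (h : IsSliceChart ι ψ φ L)
    (hS : IsTotallyGeodesic 𝓘(ℝ, E) 𝓘(ℝ, F) ι) {s : S} (hs : s ∈ ψ.source) (a b : F) :
    ∃ c, coordField φ (L c) (ι s)
      = leviCivita 𝓘(ℝ, E) M (coordField φ (L a)) (ι s) (coordField φ (L b) (ι s)) := by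
  refine (h.mem_submanifoldTangentSpace hs).1 (hS s (coordField φ (L a)) φ.source φ.open_source
    (h.mapsTo hs) (contMDiffOn_coordField h.mem_right _) ?_ _
    ((h.mem_submanifoldTangentSpace hs).2 ⟨b, rfl⟩))
  filter_upwards [ψ.open_source.mem_nhds hs] with t ht
  exact (h.mem_submanifoldTangentSpace ht).2 ⟨a, rfl⟩

theorem IsSliceChart.pullbackForm_eq_zero_iff (h : IsSliceChart ι ψ φ L) {s : S}
    (hs : s ∈ ψ.source) :
    pullbackForm φ L X (ψ s) = 0 ↔ X (ι s) ∈ submanifoldNormalSpace 𝓘(ℝ, E) 𝓘(ℝ, F) ι s := by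
  rw [submanifoldNormalSpace, Submodule.mem_orthogonal']
  simp only [h.mem_submanifoldTangentSpace hs, forall_exists_index, forall_apply_eq_imp_iff]
  rw [← h.symm_apply hs]
  exact ⟨fun h0 a ↦ congrArg (fun T : F →L[ℝ] ℝ ↦ T a) h0, fun h0 ↦ ContinuousLinearMap.ext h0⟩

variable (F ι X) in
/-- `X` is normal to the submanifold at `s`, and so are its covariant derivatives in directions
tangent to the submanifold. -/
def IsNormalToFirstOrder (s : S) : Prop :=
  X (ι s) ∈ submanifoldNormalSpace 𝓘(ℝ, E) 𝓘(ℝ, F) ι s ∧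
    ∀ v ∈ submanifoldTangentSpace 𝓘(ℝ, E) 𝓘(ℝ, F) ι s,
      leviCivita 𝓘(ℝ, E) M X (ι s) v ∈ submanifoldNormalSpace 𝓘(ℝ, E) 𝓘(ℝ, F) ι s

theorem IsSliceChart.isNormalToFirstOrder_iff (h : IsSliceChart ι ψ φ L)
    (hS : IsTotallyGeodesic 𝓘(ℝ, E) 𝓘(ℝ, F) ι) (hX : CMDiff ∞ (T% X)) {s : S}
    (hs : s ∈ ψ.source) :
    IsNormalToFirstOrder F ι X s ↔
      pullbackForm φ L X (ψ s) = 0 ∧ fderiv ℝ (pullbackForm φ L X) (ψ s) = 0 := by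
  rw [IsNormalToFirstOrder, ← h.pullbackForm_eq_zero_iff hs]
  refine and_congr_right fun h0 ↦ ?_
  have hn := (h.pullbackForm_eq_zero_iff hs).1 h0
  rw [submanifoldNormalSpace, Submodule.mem_orthogonal'] at hn
  have hD : ∀ a b, fderiv ℝ (pullbackForm φ L X) (ψ s) b a
      = inner ℝ (leviCivita 𝓘(ℝ, E) M X (ι s) (coordField φ (L b) (ι s)))
        (coordField φ (L a) (ι s)) := by
    intro a b
    rw [fderiv_pullbackForm h.mem_right hX.contMDiffOn (h.map_mem_target hs) (h.symm_apply hs)]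
    obtain ⟨c, hc⟩ := h.leviCivita_coordField_mem hS hs a b
    -- The Christoffel term is tangent and `X` is normal here, so only `⟨∇X, ·⟩` survives.
    rw [← hc, hn _ ((h.mem_submanifoldTangentSpace hs).2 ⟨c, rfl⟩), add_zero]
  simp only [submanifoldNormalSpace, Submodule.mem_orthogonal', h.mem_submanifoldTangentSpace hs,
    forall_exists_index, forall_apply_eq_imp_iff, ← hD]
  exact ⟨fun h1 ↦ by ext b a; exact h1 b a, fun h1 b a ↦ by rw [h1]; rfl⟩

/-- Unique continuation applies because one tangent direction `c` represents the ambient `∇` of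
coordinate fields: it solves the Christoffel equation of the pulled-back metric and appears in the
Killing equation of the pulled-back form. -/
theorem IsSliceChart.eventually_isNormalToFirstOrder (h : IsSliceChart ι ψ φ L)
    (hS : IsTotallyGeodesic 𝓘(ℝ, E) 𝓘(ℝ, F) ι) (hX : IsKillingField X) {s : S}
    (hs : s ∈ ψ.source) (hn : IsNormalToFirstOrder F ι X s) :
    ∀ᶠ t in nhds s, IsNormalToFirstOrder F ι X t := by
  obtain ⟨h0, h1⟩ := (h.isNormalToFirstOrder_iff hS hX.contMDiff hs).1 hn
  have hmaps := h.mapsTo_target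
  have hev := eventually_jet_eq_zero_of_killing (g := pullbackMetric φ L) ψ.open_target
    ((contDiffOn_pullbackForm h.mem_right hX.contMDiff.contMDiffOn hmaps).of_le ENat.LEInfty.out)
    ((contDiffOn_pullbackMetric h.mem_right hmaps).of_le ENat.LEInfty.out)
    (fun u hu a ha ↦ ?_) (fun u hu a b ↦ ?_) (ψ.map_source hs) h0 h1
  · filter_upwards [ψ.open_source.mem_nhds hs, (ψ.continuousAt hs).eventually hev] with t ht ht'
    exact (h.isNormalToFirstOrder_iff hS hX.contMDiff ht).2 ht'
  · rw [pullbackMetric_apply, pullbackForm_apply, inner_self_eq_zero] at ha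
    have := eq_zero_of_coordField_eq_zero h.mem_right (hmaps hu) ha
    exact h.injective (this.trans (map_zero L).symm)
  · obtain ⟨t, ht, rfl⟩ : ∃ t ∈ ψ.source, ψ t = u := ⟨ψ.symm u, ψ.map_target hu, ψ.right_inv hu⟩
    obtain ⟨c, hc⟩ := h.leviCivita_coordField_mem hS ht b a
    have hx := h.symm_apply ht
    refine ⟨c, fun d ↦ ?_, ?_⟩
    · rw [← two_mul_inner_leviCivita_coordField h.mem_right (hmaps hu) hx, ← hc,
        pullbackMetric_apply, pullbackForm_apply, hx]
    -- Symmetrizing the derivative removes the `∇X` terms by skew-symmetry; torsion-freeness turns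
    -- the two Christoffel terms into twice the same one.
    · have hk := hX.inner_leviCivita φ.open_source (contMDiffOn_coordField h.mem_right (L a))
        (contMDiffOn_coordField h.mem_right (L b)) (h.mapsTo ht)
      rw [fderiv_pullbackForm h.mem_right hX.contMDiff.contMDiffOn (hmaps hu) hx,
        fderiv_pullbackForm h.mem_right hX.contMDiff.contMDiffOn (hmaps hu) hx,
        leviCivita_coordField_comm h.mem_right (h.mapsTo ht) (L a) (L b), ← hc,
        pullbackForm_apply, hx]
      rw [real_inner_comm (leviCivita 𝓘(ℝ, E) M X (ι t) (coordField φ (L b) (ι t)))] at hk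
      linarith

/-- The first jet of the form is continuous, so it stays nonzero near a point where it is nonzero.
-/
theorem IsSliceChart.eventually_not_isNormalToFirstOrder (h : IsSliceChart ι ψ φ L)
    (hS : IsTotallyGeodesic 𝓘(ℝ, E) 𝓘(ℝ, F) ι) (hX : CMDiff ∞ (T% X)) {s : S}
    (hs : s ∈ ψ.source) (hn : ¬ IsNormalToFirstOrder F ι X s) :
    ∀ᶠ t in nhds s, ¬ IsNormalToFirstOrder F ι X t := by
  have hc := contDiffOn_pullbackForm h.mem_right (X := X) hX.contMDiffOn h.mapsTo_target
  have ht := ψ.open_target.mem_nhds (ψ.map_source hs)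
  have c0 := (hc.continuousOn.continuousAt ht).comp (ψ.continuousAt hs)
  have c1 := ((hc.continuousOn_fderiv_of_isOpen ψ.open_target (by simp)).continuousAt ht).comp
    (ψ.continuousAt hs)
  rw [h.isNormalToFirstOrder_iff hS hX hs, ← Prod.mk_eq_zero] at hn
  filter_upwards [ψ.open_source.mem_nhds hs, (c0.prodMk c1).eventually_ne hn] with t ht ht'
  rw [h.isNormalToFirstOrder_iff hS hX ht, ← Prod.mk_eq_zero]
  exact ht'

end Submanifold

end RiemannianGeometry

end

theorem lemma5
    -- a smooth finite-dimensional Riemannian manifold `M`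
    {E : Type*} [NormedAddCommGroup E] [NormedSpace ℝ E] [FiniteDimensional ℝ E]
    {M : Type*} [TopologicalSpace M] [T2Space M] [ChartedSpace E M] [IsManifold 𝓘(ℝ, E) ∞ M]
    [RiemannianBundle (fun x : M ↦ TangentSpace 𝓘(ℝ, E) x)]
    [IsContMDiffRiemannianBundle 𝓘(ℝ, E) ∞ E (fun x : M ↦ TangentSpace 𝓘(ℝ, E) x)]
    -- a connected, immersed, totally geodesic submanifold `ι : S → M`
    {F : Type*} [NormedAddCommGroup F] [NormedSpace ℝ F] [FiniteDimensional ℝ F]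
    {S : Type*} [TopologicalSpace S] [T2Space S] [ConnectedSpace S] [ChartedSpace F S]
    [IsManifold 𝓘(ℝ, F) ∞ S]
    (ι : S → M) (hι : Manifold.IsImmersion 𝓘(ℝ, F) 𝓘(ℝ, E) ∞ ι)
    (hS : RiemannianGeometry.IsTotallyGeodesic 𝓘(ℝ, E) 𝓘(ℝ, F) ι)
    (p : S)
    (X : Π x : M, TangentSpace 𝓘(ℝ, E) x) (hX : RiemannianGeometry.IsKillingField X) :
    (∀ q : S, X (ι q) ∈ RiemannianGeometry.submanifoldNormalSpace 𝓘(ℝ, E) 𝓘(ℝ, F) ι q) ↔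
      X (ι p) ∈ RiemannianGeometry.submanifoldNormalSpace 𝓘(ℝ, E) 𝓘(ℝ, F) ι p ∧
      ∀ v ∈ RiemannianGeometry.submanifoldTangentSpace 𝓘(ℝ, E) 𝓘(ℝ, F) ι p,
        RiemannianGeometry.leviCivita 𝓘(ℝ, E) M X (ι p) v
          ∈ RiemannianGeometry.submanifoldNormalSpace 𝓘(ℝ, E) 𝓘(ℝ, F) ι p := by
  constructor
  · intro h
    obtain ⟨ψ, φ, L, hp, hs⟩ := RiemannianGeometry.exists_isSliceChart hι p
    refine (hs.isNormalToFirstOrder_iff hS hX.contMDiff hp).2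
      ⟨(hs.pullbackForm_eq_zero_iff hp).2 (h p), ?_⟩
    -- Normality at all points of the slice makes the form vanish on a neighbourhood, hence its
    -- derivative vanishes too.
    have hz : RiemannianGeometry.pullbackForm φ L X =ᶠ[nhds (ψ p)] fun _ ↦ 0 := by
      filter_upwards [ψ.open_target.mem_nhds (ψ.map_source hp)] with u hu
      rw [← ψ.right_inv hu]
      exact (hs.pullbackForm_eq_zero_iff (ψ.map_target hu)).2 (h _)
    rw [hz.fderiv_eq]
    simp
  · intro h
    -- Continuity of the jet gives closedness, unique continuation gives openness; `p` lies in the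
    -- set by hypothesis.
    have hclopen : IsClopen {s : S | RiemannianGeometry.IsNormalToFirstOrder F ι X s} := by
      constructor
      · rw [← isOpen_compl_iff, isOpen_iff_mem_nhds]
        intro s hs
        obtain ⟨ψ, φ, L, hsψ, hc⟩ := RiemannianGeometry.exists_isSliceChart hι s
        exact hc.eventually_not_isNormalToFirstOrder hS hX.contMDiff hsψ hs
      · rw [isOpen_iff_mem_nhds]
        intro s hs
        obtain ⟨ψ, φ, L, hsψ, hc⟩ := RiemannianGeometry.exists_isSliceChart hι s
        exact hc.eventually_isNormalToFirstOrder hS hX hsψ hs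
    have huniv := hclopen.eq_univ ⟨p, h⟩
    exact fun q ↦ (Set.eq_univ_iff_forall.1 huniv q).1
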